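/- Let $k \ge 1$ be an integer and $[k] = \{1,\dots,k\}$. Let $P_k$ be the poset whose elements are the ordered pairs $(I,J)$ of nonempty, proper, disjoint subsets $I, J \subseteq [k]$, together with one additional minimum element $\hat 0$, ordered by $(R,T) \preceq (I,J)$ if and only if $I \subseteq R$ and $J \subseteq T$. Let $$\mathbf V = \begin{pmatrix} I_{k-1} & \mathbf 1 \end{pmatrix} \in \mathbb R^{(k-1)\times k}$$ be the matrix whose first $k-1$ columns form the identity matrix and whose last column has all entries equal to $1$, and let $$Z(\mathbf V) = \{\mathbf V\mathbf x : \mathbf x \in [0,1]^k\} \subseteq \mathbb R^{k-1}$$ be the zonotope which is the image of the unit $k$-cube under $\mathbf x \mapsto \mathbf V \mathbf x$. A face of $Z(\mathbf V)$ is a set of the form $\{z \in Z(\mathbf V) : c\cdot z = b\}$, where $c \in \mathbb R^{k-1}$ and $b \in \mathbb R$ satisfy $c \cdot z \le b$ for all $z \in Z(\mathbf V)$. Then $P_k$ is isomorphic, as a partially ordered set, to the face lattice of the boundary of $Z(\mathbf V)$, that is, to the set of all faces of $Z(\mathbf V)$ other than $Z(\mathbf V)$ itself (including the empty face), ordered by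 inclusion. -/

import Mathlib

/-- The ordered pairs `(I, J)` of nonempty, proper, disjoint subsets of a `k`-element set. -/
@[ext]
structure DisjointSupportPair (k : ℕ) where
  I : Finset (Fin k)
  J : Finset (Fin k)
  I_nonempty : I.Nonempty
  J_nonempty : J.Nonempty
  I_proper : I ≠ Finset.univ
  J_proper : J ≠ Finset.univ
  disjoint : Disjoint I J

/-- `(R, T) ≼ (I, J)` when `I ⊆ R` and `J ⊆ T`: larger supports are smaller elements. -/
instance DisjointSupportPair.instPartialOrder (k : ℕ) : PartialOrder (DisjointSupportPair k) where
  le a b := b.I ⊆ a.I ∧ b.J ⊆ a.J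
  le_refl a := ⟨Finset.Subset.refl _, Finset.Subset.refl _⟩
  le_trans a b c hab hbc :=
    ⟨Finset.Subset.trans hbc.1 hab.1, Finset.Subset.trans hbc.2 hab.2⟩
  le_antisymm a b hab hba :=
    DisjointSupportPair.ext (Finset.Subset.antisymm hba.1 hab.1)
      (Finset.Subset.antisymm hba.2 hab.2)

/-- The ordered poset of disjoint supports on `k` elements: the ordered pairs of disjoint supports
together with one additional minimum element `⊥`. -/
abbrev OrderedDisjointSupports (k : ℕ) : Type := WithBot (DisjointSupportPair k)

/-- The `d`-dimensional unit hypercube in `ℝ^d`. -/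
def unitCube (d : ℕ) : Set (Fin d → ℝ) := {x | ∀ j, 0 ≤ x j ∧ x j ≤ 1}

/-- The zonotope `Z(V) = V · C_d ⊆ ℝ^p` of the vector configuration given by the columns of `V`. -/
def zonotope {p d : ℕ} (V : Matrix (Fin p) (Fin d) ℝ) : Set (Fin p → ℝ) :=
  (fun x => V.mulVec x) '' unitCube d

/-- `F` is a face of `P` if `F = P ∩ {x | c · x = b}` for a linear inequality `c · x ≤ b` which is
valid on `P`. As usual `c = 0` is allowed, so that `∅` and `P` itself are faces of `P`. -/
def IsPolytopeFace {p : ℕ} (P F : Set (Fin p → ℝ)) : Prop :=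
  ∃ (c : Fin p → ℝ) (b : ℝ), (∀ x ∈ P, c ⬝ᵥ x ≤ b) ∧ F = P ∩ {x | c ⬝ᵥ x = b}

/-- The faces of the boundary of `P`: all proper faces of `P` (the empty face included), partially
ordered by inclusion. -/
abbrev BoundaryFace {p : ℕ} (P : Set (Fin p → ℝ)) : Type :=
  {F : Set (Fin p → ℝ) // IsPolytopeFace P F ∧ F ≠ P}

/-- The `(k - 1) × k` matrix `(I_{k-1} | 𝟏)`: the last column consists of ones, and the columns
before it form the identity matrix. -/
def identityOnes (k : ℕ) : Matrix (Fin (k - 1)) (Fin k) ℝ :=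
  Matrix.of fun i j => if (j : ℕ) = k - 1 then 1 else if (i : ℕ) = (j : ℕ) then 1 else 0

/-! Up to a translation, the zonotope is the cube projected along the all-ones direction. Linear
functionals on the image correspond to vectors `y` with coordinate sum zero, and such a `y` is
maximal on the cube face fixed to `1` where `y > 0` and to `0` where `y < 0` (`sum_mul_le_sum_max`).
If `y ≠ 0`, sum zero forces both sign sets to be nonempty, and every disjoint nonempty pair arises
this way. On these faces the projection loses nothing (`mem_image_cubeFace_iff`), so inclusion of
faces is reverse inclusion of supports; `⊥` goes to the empty face. -/

/-- The map `u ↦ (uᵢ - uₙ + 1)ᵢ`, which is `(I | 𝟏)` precomposed with the reflection `uₙ ↦ 1 - uₙ`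
of the unit cube. -/
def differenceMap (n : ℕ) (u : Fin (n + 1) → ℝ) : Fin n → ℝ :=
  fun i => u i.castSucc - u (Fin.last n) + 1

/-- The face of the unit cube on which the coordinates in `I` are `1` and those in `J` are `0`. -/
def cubeFace {d : ℕ} (I J : Finset (Fin d)) : Set (Fin d → ℝ) :=
  {u | u ∈ unitCube d ∧ (∀ j ∈ I, u j = 1) ∧ ∀ j ∈ J, u j = 0}

theorem identityOnes_mulVec (n : ℕ) (x : Fin (n + 1) → ℝ) (i : Fin n) :
    (identityOnes (n + 1)).mulVec x i = x i.castSucc + x (Fin.last n) := by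
  have h : ∀ j : Fin n, ((j : ℕ) = n) = False := fun j => by simpa using j.2.ne
  simp only [Matrix.mulVec, dotProduct, identityOnes, Matrix.of_apply, Fin.sum_univ_castSucc,
    Nat.add_sub_cancel, Fin.val_castSucc, Fin.val_last, h, if_true, if_false, one_mul]
  simp [← Fin.ext_iff]

theorem zonotope_identityOnes (n : ℕ) :
    zonotope (identityOnes (n + 1)) = differenceMap n '' unitCube (n + 1) := by
  have flip_mem : ∀ x ∈ unitCube (n + 1),
      (fun j => if j = Fin.last n then 1 - x j else x j) ∈ unitCube (n + 1) := by
    intro x hx j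
    have := hx j
    dsimp only
    split_ifs
    · constructor <;> linarith
    · exact this
  apply Set.Subset.antisymm
  · rintro _ ⟨x, hx, rfl⟩
    refine ⟨_, flip_mem x hx, funext fun i => ?_⟩
    refine Eq.trans ?_ (identityOnes_mulVec n x i).symm
    simp [differenceMap, Fin.castSucc_ne_last]
    ring
  · rintro _ ⟨x, hx, rfl⟩
    refine ⟨_, flip_mem x hx, funext fun i => ?_⟩
    refine (identityOnes_mulVec n _ i).trans ?_
    simp [differenceMap, Fin.castSucc_ne_last]
    ring

theorem cubeFace_subset_unitCube {d : ℕ} (I J : Finset (Fin d)) : cubeFace I J ⊆ unitCube d :=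
  fun _ h => h.1

/-- A functional `∑ yⱼ uⱼ` is bounded on the cube by the sum of the positive parts of its
coefficients, with equality exactly on the cube face given by the signs of `y`. -/
theorem sum_mul_le_sum_max {d : ℕ} (y u : Fin d → ℝ) (hu : u ∈ unitCube d) :
    ∑ j, y j * u j ≤ ∑ j, max (y j) 0 ∧
      (∑ j, y j * u j = ∑ j, max (y j) 0 ↔
        u ∈ cubeFace (Finset.univ.filter (0 < y ·)) (Finset.univ.filter (y · < 0))) := by
  have hle : ∀ j ∈ Finset.univ, y j * u j ≤ max (y j) 0 := by
    intro j _
    obtain ⟨h0, h1⟩ := hu j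
    rcases le_total 0 (y j) with h | h
    · exact (mul_le_of_le_one_right h h1).trans (le_max_left _ _)
    · exact (mul_nonpos_of_nonpos_of_nonneg h h0).trans (le_max_right _ _)
  refine ⟨Finset.sum_le_sum hle, ?_⟩
  rw [Finset.sum_eq_sum_iff_of_le hle]
  constructor
  · refine fun h => ⟨hu, fun j hj => ?_, fun j hj => ?_⟩
    · have hy : 0 < y j := by simpa using hj
      have := h j (Finset.mem_univ j)
      rw [max_eq_left hy.le] at this
      exact (mul_eq_left₀ hy.ne').1 this
    · have hy : y j < 0 := by simpa using hj
      have := h j (Finset.mem_univ j)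
      rw [max_eq_right hy.le] at this
      exact (mul_eq_zero.1 this).resolve_left hy.ne
  · rintro ⟨-, h1, h0⟩ j -
    rcases lt_trichotomy (y j) 0 with h | h | h
    · rw [h0 j (by simpa using h), max_eq_right h.le, mul_zero]
    · simp [h]
    · rw [h1 j (by simpa using h), max_eq_left h.le, mul_one]

/-- Sum zero makes `y` vanish on the all-ones vector, so it descends to the projection; the constant
comes from the `+ 1` in `differenceMap`. -/
theorem dotProduct_differenceMap {n : ℕ} (y : Fin (n + 1) → ℝ) (hy : ∑ j, y j = 0)
    (u : Fin (n + 1) → ℝ) :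
    (fun i : Fin n => y i.castSucc) ⬝ᵥ differenceMap n u =
      ∑ j, y j * u j + ∑ i : Fin n, y i.castSucc := by
  rw [Fin.sum_univ_castSucc] at hy ⊢
  rw [eq_neg_of_add_eq_zero_right hy, neg_mul, Finset.sum_mul, ← Finset.sum_neg_distrib,
    ← Finset.sum_add_distrib, ← Finset.sum_add_distrib]
  exact Finset.sum_congr rfl fun i _ => by simp only [differenceMap]; ring

/-- The face of the projected cube on which the functional with coefficients `y` is maximal. -/
theorem inter_maximal_eq_image_cubeFace {n : ℕ} (y : Fin (n + 1) → ℝ) (hy : ∑ j, y j = 0) :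
    differenceMap n '' unitCube (n + 1) ∩ {z | (fun i : Fin n => y i.castSucc) ⬝ᵥ z =
        ∑ j, max (y j) 0 + ∑ i : Fin n, y i.castSucc} =
      differenceMap n ''
        cubeFace (Finset.univ.filter (0 < y ·)) (Finset.univ.filter (y · < 0)) := by
  ext z
  constructor
  · rintro ⟨⟨u, hu, rfl⟩, h⟩
    rw [Set.mem_ofPred_eq, dotProduct_differenceMap y hy, add_left_inj] at h
    exact ⟨u, (sum_mul_le_sum_max y u hu).2.1 h, rfl⟩
  · rintro ⟨u, hu, rfl⟩
    refine ⟨⟨u, hu.1, rfl⟩, ?_⟩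
    rw [Set.mem_ofPred_eq, dotProduct_differenceMap y hy, add_left_inj]
    exact (sum_mul_le_sum_max y u hu.1).2.2 hu

theorem cubeFace_nonempty {d : ℕ} {I J : Finset (Fin d)} (h : Disjoint I J) :
    (cubeFace I J).Nonempty := by
  refine ⟨fun j => if j ∈ I then 1 else 0, fun j => ?_, fun j hj => if_pos hj,
    fun j hj => if_neg (Finset.disjoint_right.1 h hj)⟩
  dsimp only
  split_ifs <;> norm_num

theorem isPolytopeFace_image_cubeFace {n : ℕ} (a : DisjointSupportPair (n + 1)) :
    IsPolytopeFace (differenceMap n '' unitCube (n + 1))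
      (differenceMap n '' cubeFace a.I a.J) := by
  have hI : (0 : ℝ) < a.I.card := by exact_mod_cast a.I_nonempty.card_pos
  have hJ : (0 : ℝ) < a.J.card := by exact_mod_cast a.J_nonempty.card_pos
  -- The weights make the positive part sum to `1` and the negative part to `-1`.
  let y : Fin (n + 1) → ℝ := fun j =>
    (if j ∈ a.I then (a.I.card : ℝ)⁻¹ else 0) - if j ∈ a.J then (a.J.card : ℝ)⁻¹ else 0
  have hy : ∑ j, y j = 0 := by
    simp [y, Finset.sum_sub_distrib, hI.ne', hJ.ne']
  have hpos : Finset.univ.filter (0 < y ·) = a.I := by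
    ext j
    have : j ∈ a.I → j ∉ a.J := fun h => Finset.disjoint_left.1 a.disjoint h
    by_cases h1 : j ∈ a.I <;> by_cases h2 : j ∈ a.J <;> simp_all [y, hJ.le]
  have hneg : Finset.univ.filter (y · < 0) = a.J := by
    ext j
    have : j ∈ a.I → j ∉ a.J := fun h => Finset.disjoint_left.1 a.disjoint h
    by_cases h1 : j ∈ a.I <;> by_cases h2 : j ∈ a.J <;> simp_all [y, hI.le]
  refine ⟨fun i => y i.castSucc, ∑ j, max (y j) 0 + ∑ i : Fin n, y i.castSucc, ?_, ?_⟩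
  · rintro _ ⟨u, hu, rfl⟩
    rw [dotProduct_differenceMap y hy, add_le_add_iff_right]
    exact (sum_mul_le_sum_max y u hu).1
  · rw [inter_maximal_eq_image_cubeFace y hy, hpos, hneg]

/-- On the cube faces of pairs of nonempty sets, `differenceMap` loses no information. -/
theorem mem_image_cubeFace_iff {n : ℕ} {I J R T : Finset (Fin (n + 1))} (hI : I.Nonempty)
    (hJ : J.Nonempty) {u : Fin (n + 1) → ℝ}
    (hu : u ∈ cubeFace I J) :
    differenceMap n u ∈ differenceMap n '' cubeFace R T ↔ u ∈ cubeFace R T := by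
  refine ⟨?_, fun h => ⟨u, h, rfl⟩⟩
  rintro ⟨v, hv, h⟩
  have hdiff : ∀ j, v j - u j = v (Fin.last n) - u (Fin.last n) := by
    intro j
    induction j using Fin.lastCases with
    | last => rfl
    | cast i =>
      have := congrFun h i
      simp only [differenceMap] at this
      linarith
  obtain ⟨i, hi⟩ := hI
  obtain ⟨j, hj⟩ := hJ
  -- Two points of a fibre differ by a multiple of the all-ones vector. A coordinate of `u` equal to
  -- `1` blocks a positive shift inside the cube, one equal to `0` a negative shift.
  have hzero : v (Fin.last n) - u (Fin.last n) = 0 := by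
    apply le_antisymm
    · rw [← hdiff i, hu.2.1 i hi]
      linarith [(hv.1 i).2]
    · rw [← hdiff j, hu.2.2 j hj]
      linarith [(hv.1 j).1]
  have : v = u := funext fun j => sub_eq_zero.1 ((hdiff j).trans hzero)
  exact this ▸ hv

theorem image_cubeFace_subset_iff {n : ℕ} (a b : DisjointSupportPair (n + 1)) :
    differenceMap n '' cubeFace a.I a.J ⊆ differenceMap n '' cubeFace b.I b.J ↔ a ≤ b := by
  constructor
  · intro h
    -- A relative interior point of the face: its coordinates are `1` or `0` only where forced.
    let u : Fin (n + 1) → ℝ := fun j => if j ∈ a.I then 1 else if j ∈ a.J then 0 else 1 / 2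
    have hu : u ∈ cubeFace a.I a.J := by
      refine ⟨fun j => ?_, fun j hj => if_pos hj, fun j hj => ?_⟩
      · simp only [u]
        split_ifs <;> norm_num
      · simp [u, hj, Finset.disjoint_right.1 a.disjoint hj]
    have hub := (mem_image_cubeFace_iff a.I_nonempty a.J_nonempty hu).1
      (h ⟨u, hu, rfl⟩)
    constructor
    · intro j hj
      by_contra hja
      have := hub.2.1 j hj
      simp only [u, if_neg hja] at this
      split_ifs at this <;> norm_num at this
    · intro j hj
      by_contra hja
      have := hub.2.2 j hj
      simp only [u, if_neg hja] at this
      split_ifs at this <;> norm_num at this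
  · rintro ⟨hI, hJ⟩
    exact Set.image_mono fun u hu =>
      ⟨hu.1, fun j hj => hu.2.1 j (hI hj), fun j hj => hu.2.2 j (hJ hj)⟩

/-- A face equal to everything would contain the opposite face, with `I` and `J` swapped, forcing `I
⊆ J`. -/
theorem image_cubeFace_ne {n : ℕ} (a : DisjointSupportPair (n + 1)) :
    differenceMap n '' cubeFace a.I a.J ≠ differenceMap n '' unitCube (n + 1) := by
  intro h
  let b : DisjointSupportPair (n + 1) :=
    ⟨a.J, a.I, a.J_nonempty, a.I_nonempty, a.J_proper, a.I_proper, a.disjoint.symm⟩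
  have hba : b ≤ a := (image_cubeFace_subset_iff b a).1
    ((Set.image_mono (cubeFace_subset_unitCube _ _)).trans h.ge)
  obtain ⟨i, hi⟩ := a.I_nonempty
  exact Finset.disjoint_left.1 a.disjoint hi (hba.1 hi)

theorem isPolytopeFace_empty {p : ℕ} (P : Set (Fin p → ℝ)) : IsPolytopeFace P ∅ :=
  ⟨0, 1, by simp, by simp⟩

/-- Every nonempty proper face of the projected cube comes from a pair of disjoint supports. -/
theorem exists_eq_image_cubeFace {n : ℕ} {F : Set (Fin n → ℝ)}
    (hF : IsPolytopeFace (differenceMap n '' unitCube (n + 1)) F)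
    (hne : F ≠ differenceMap n '' unitCube (n + 1)) (hF0 : F.Nonempty) :
    ∃ a : DisjointSupportPair (n + 1), differenceMap n '' cubeFace a.I a.J = F := by
  obtain ⟨c, b, hb, rfl⟩ := hF
  let y : Fin (n + 1) → ℝ := Fin.snoc c (-∑ i, c i)
  have hyc : (fun i : Fin n => y i.castSucc) = c := by
    funext i
    simp [y]
  have hy : ∑ j, y j = 0 := by
    simp [y, Fin.sum_univ_castSucc]
  have hdisj : Disjoint (Finset.univ.filter (0 < y ·)) (Finset.univ.filter (y · < 0)) :=
    Finset.disjoint_filter.2 fun _ _ h => h.not_gt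
  -- As the face is nonempty, the bound `b` is attained and hence is the maximum.
  have hbmax : b = ∑ j, max (y j) 0 + ∑ i : Fin n, y i.castSucc := by
    apply le_antisymm
    · obtain ⟨_, ⟨u, hu, rfl⟩, h⟩ := hF0
      rw [Set.mem_ofPred_eq, ← hyc, dotProduct_differenceMap y hy] at h
      rw [← h, add_le_add_iff_right]
      exact (sum_mul_le_sum_max y u hu).1
    · obtain ⟨u, hu⟩ := cubeFace_nonempty hdisj
      have := hb _ ⟨u, hu.1, rfl⟩
      rwa [← hyc, dotProduct_differenceMap y hy, (sum_mul_le_sum_max y u hu.1).2.2 hu] at this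
  have hface := inter_maximal_eq_image_cubeFace y hy
  rw [← hbmax, hyc] at hface
  -- If `y = 0`, both sign sets are empty and the face is the whole zonotope.
  have hy0 : ∃ j ∈ Finset.univ, y j ≠ 0 := by
    by_contra! h
    refine hne (hface.trans (congrArg _ ?_))
    ext u
    simp [cubeFace, h]
  have hpos : (Finset.univ.filter (0 < y ·)).Nonempty := by
    obtain ⟨j, hj, h⟩ := Finset.exists_pos_of_sum_zero_of_exists_nonzero y hy hy0
    exact ⟨j, by simpa using h⟩
  have hneg : (Finset.univ.filter (y · < 0)).Nonempty := by
    obtain ⟨j, hj, h⟩ := Finset.exists_pos_of_sum_zero_of_exists_nonzero (s := Finset.univ)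
      (fun j => -y j) (by simp [hy]) (by simpa using hy0)
    exact ⟨j, by simpa using h⟩
  refine ⟨⟨_, _, hpos, hneg, fun h => ?_, fun h => ?_, hdisj⟩, hface.symm⟩
  · obtain ⟨j, hj⟩ := hneg
    exact Finset.disjoint_right.1 hdisj hj (Finset.eq_univ_iff_forall.1 h j)
  · obtain ⟨j, hj⟩ := hpos
    exact Finset.disjoint_left.1 hdisj hj (Finset.eq_univ_iff_forall.1 h j)

/-- The boundary face of the projected cube attached to an element of the poset of supports. -/
def supportFace (n : ℕ) :
    OrderedDisjointSupports (n + 1) → BoundaryFace (differenceMap n '' unitCube (n + 1))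
  | ⊥ => ⟨∅, isPolytopeFace_empty _, fun h => by
      have : (0 : Fin (n + 1) → ℝ) ∈ unitCube (n + 1) := fun _ => ⟨le_rfl, zero_le_one⟩
      exact Set.notMem_empty _ (h.ge ⟨0, this, rfl⟩)⟩
  | (a : DisjointSupportPair (n + 1)) =>
    ⟨differenceMap n '' cubeFace a.I a.J, isPolytopeFace_image_cubeFace a, image_cubeFace_ne a⟩

theorem supportFace_le_iff (n : ℕ) (a b : OrderedDisjointSupports (n + 1)) :
    supportFace n a ≤ supportFace n b ↔ a ≤ b := by
  induction a using WithBot.recBotCoe with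
  | bot => exact iff_of_true (Set.empty_subset _) bot_le
  | coe a =>
    induction b using WithBot.recBotCoe with
    | bot =>
      refine iff_of_false (fun h => ?_) (WithBot.not_coe_le_bot a)
      obtain ⟨u, hu⟩ := cubeFace_nonempty a.disjoint
      exact Set.notMem_empty _ (h ⟨u, hu, rfl⟩)
    | coe b => exact (image_cubeFace_subset_iff a b).trans WithBot.coe_le_coe.symm

theorem supportFace_surjective (n : ℕ) : Function.Surjective (supportFace n) := by
  rintro ⟨F, hF, hne⟩
  rcases F.eq_empty_or_nonempty with rfl | hF0
  · exact ⟨⊥, rfl⟩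
  · obtain ⟨a, rfl⟩ := exists_eq_image_cubeFace hF hne hF0
    exact ⟨a, rfl⟩

theorem theorem4p5 (k : ℕ) (hk : 1 ≤ k) :
    Nonempty (OrderedDisjointSupports k ≃o BoundaryFace (zonotope (identityOnes k))) := by
  obtain ⟨n, rfl⟩ := Nat.exists_eq_add_of_le' hk
  rw [zonotope_identityOnes]
  exact ⟨RelIso.ofSurjective (OrderEmbedding.ofMapLEIff _ (supportFace_le_iff n))
    (supportFace_surjective n)⟩
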